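/- Consider oriented Legendrian knots $\Lambda$ in $\mathbb{R}^3$ with its standard contact structure $\ker(dz-y\,dx)$, up to Legendrian isotopy, and describe them by their generic oriented front projections to the $xz$-plane: closed curves without vertical tangencies whose only singularities are transverse double points (crossings, at which the strand of smaller slope is the overstrand) and semicubical cusps. Two such fronts represent the same $\Lambda$ if and only if they are related by planar isotopies through fronts and Legendrian Reidemeister moves. If a front of $\Lambda$ has $P$ positive crossings, $N$ negative crossings and $C = D+U$ cusps, of which $D$ are traversed downward and $U$ are traversed upward, then $$\operatorname{tb}(\Lambda)=P-N-\tfrac12 C,\qquad \operatorname{rot}(\Lambda)=\tfrac12(D-U);$$ these numbers depend only on $\Lambda$. A Legendrian $n$-mosaic is an $n\times n$ array of the following ten square tiles, the whole array being rotated counterclockwise by $45^\circ$. Before the rotation the strands of the tiles join midpoints of edges as follows: $T_0$ is empty; $T_1$: left–bottom; $T_2$: bottom–right; $T_3$: right–top; $T_4$: left–top; $T_5$: left–right; $T_6$: top–bottom; $T_7$: left–bottom and right–top; $T_8$: left–top and bottom–right; $T_{10}$: left–right and top–bottom, crossing each other. After the rotation each left–top strand has a right cusp, each bottom–right strand has a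 left cusp, the other strands have no cusp, and in $T_{10}$ the strand of negative slope is the overstrand. The mosaic is suitably connected if the connection points of adjacent tiles coincide and there are none on the boundary of the array; it then depicts a front. The mosaic number $m(\Lambda)$ is the smallest $n$ such that some suitably connected Legendrian $n$-mosaic depicts, with a suitable orientation, a front of $\Lambda$. Theorem. If $\Lambda$ is a Legendrian knot with $4|\operatorname{rot}(\Lambda)|+\operatorname{tb}(\Lambda)\ge 0$, then $$m(\Lambda)\ \ge\ \left\lceil\sqrt{4|\operatorname{rot}(\Lambda)|+\operatorname{tb}(\Lambda)}\,\right\rceil .$$ -/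

import Mathlib

/-!
# Legendrian knots through their front projections, and Legendrian mosaics

The front projection of a generic Legendrian link in `(ℝ³, ker (dz - y dx))` is a closed curve in
the `xz`-plane without vertical tangencies whose only singularities are transverse double points
(crossings) and semicubical cusps; generically they have pairwise distinct `x`-coordinates.  Read
from left to right, such a front is a finite word in three kinds of singular points: left cusps,
crossings and right cusps, each one located by the number of strands that pass below it.  At a
crossing the strand of smaller slope is the overstrand, so no further crossing data is needed.

Two fronts describe Legendrian isotopic links if and only if they are related by planar isotopies
through fronts and the Legendrian Reidemeister moves.
-/

namespace Legendrian

/-! ### Fronts as words -/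

/-- A singular point of a front.  Strands over a vertical line are numbered `0, 1, 2, …` from bottom
to top, and `k` is the number of strands below the singular point. -/
inductive FrontEvent : Type
  /-- `≺` : two new strands, in positions `k` and `k + 1`, are born. -/
  | leftCusp (k : ℕ)
  /-- The strands in positions `k` and `k + 1` cross. -/
  | crossing (k : ℕ)
  /-- `≻` : the strands in positions `k` and `k + 1` meet and end. -/
  | rightCusp (k : ℕ)
  deriving DecidableEq

namespace FrontEvent

/-- Number of strands below the singular point. -/
def pos : FrontEvent → ℕ
  | leftCusp k => k
  | crossing k => k
  | rightCusp k => k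

/-- Number of strands that enter the singular point from the left. -/
def inputs : FrontEvent → ℕ
  | leftCusp _ => 0
  | crossing _ => 2
  | rightCusp _ => 2

/-- Number of strands that leave the singular point to the right. -/
def outputs : FrontEvent → ℕ
  | leftCusp _ => 2
  | crossing _ => 2
  | rightCusp _ => 0

/-- The same singular point with `m` more strands below it. -/
def shift (m : ℕ) : FrontEvent → FrontEvent
  | leftCusp k => leftCusp (m + k)
  | crossing k => crossing (m + k)
  | rightCusp k => rightCusp (m + k)

end FrontEvent

/-- A singular point of an oriented front.  A strand direction is a Boolean: `true` for rightward,
`false` for leftward.  A cusp carries the flag `up`: `true` if the cusp is traversed upward, `false`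
if it is traversed downward.  A crossing carries the directions `a`, `b` of the strands which are in
position `k`, `k + 1` to the left of the crossing. -/
inductive OrientedEvent : Type
  | leftCusp (k : ℕ) (up : Bool)
  | crossing (k : ℕ) (a b : Bool)
  | rightCusp (k : ℕ) (up : Bool)
  deriving DecidableEq

namespace OrientedEvent

/-- Forget the orientation. -/
def forget : OrientedEvent → FrontEvent
  | leftCusp k _ => .leftCusp k
  | crossing k _ _ => .crossing k
  | rightCusp k _ => .rightCusp k

/-- `Step e s s'`: passing the singular point `e`, the strand directions over a vertical line,
listed from bottom to top, change from `s` to `s'`.  An upward left cusp is entered leftward along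
its lower branch and left rightward along its upper branch; an upward right cusp is entered
rightward along its lower branch and left leftward along its upper branch. -/
inductive Step : OrientedEvent → List Bool → List Bool → Prop
  | leftCusp (l r : List Bool) (up : Bool) :
      Step (.leftCusp l.length up) (l ++ r) (l ++ (!up) :: up :: r)
  | crossing (l r : List Bool) (a b : Bool) :
      Step (.crossing l.length a b) (l ++ a :: b :: r) (l ++ b :: a :: r)
  | rightCusp (l r : List Bool) (up : Bool) :
      Step (.rightCusp l.length up) (l ++ up :: (!up) :: r) (l ++ r)

/-- The overstrand of a crossing has direction `±(1, -1)` and the understrand direction `±(1, 1)`,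
so the crossing is positive exactly if both strands point to the same side. -/
def isPositive : OrientedEvent → Bool
  | crossing _ a b => a == b
  | _ => false

/-- Negative crossings. -/
def isNegative : OrientedEvent → Bool
  | crossing _ a b => a != b
  | _ => false

/-- Cusps traversed downward. -/
def isDownCusp : OrientedEvent → Bool
  | leftCusp _ up => !up
  | rightCusp _ up => !up
  | crossing _ _ _ => false

/-- Cusps traversed upward. -/
def isUpCusp : OrientedEvent → Bool
  | leftCusp _ up => up
  | rightCusp _ up => up
  | crossing _ _ _ => false

/-- Cusps. -/
def isCusp : OrientedEvent → Bool
  | crossing _ _ _ => false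
  | _ => true

end OrientedEvent

/-- `Run w s s'`: the word `w` of oriented singular points, read from left to right, leads from the
strand directions `s` to the strand directions `s'`. -/
inductive Run : List OrientedEvent → List Bool → List Bool → Prop
  | nil (s : List Bool) : Run [] s s
  | cons {e : OrientedEvent} {w : List OrientedEvent} {s s' s'' : List Bool} :
      e.Step s s' → Run w s' s'' → Run (e :: w) s s''

/-- The point `(t, p)` stands for the strand in position `p` over a vertical line between the first
`t` singular points of the word `w` and the remaining ones.  `Adj w` relates two such points that
are joined by an arc of the front which passes at most one singular point. -/
inductive Adj (w : List FrontEvent) : ℕ × ℕ → ℕ × ℕ → Prop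
  | leftCusp {t k : ℕ} : w[t]? = some (.leftCusp k) → Adj w (t + 1, k) (t + 1, k + 1)
  | leftCusp_below {t k p : ℕ} : w[t]? = some (.leftCusp k) → p < k → Adj w (t, p) (t + 1, p)
  | leftCusp_above {t k p : ℕ} : w[t]? = some (.leftCusp k) → k ≤ p → Adj w (t, p) (t + 1, p + 2)
  | crossing_rise {t k : ℕ} : w[t]? = some (.crossing k) → Adj w (t, k) (t + 1, k + 1)
  | crossing_fall {t k : ℕ} : w[t]? = some (.crossing k) → Adj w (t, k + 1) (t + 1, k)
  | crossing_away {t k p : ℕ} : w[t]? = some (.crossing k) → p ≠ k → p ≠ k + 1 →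
      Adj w (t, p) (t + 1, p)
  | rightCusp {t k : ℕ} : w[t]? = some (.rightCusp k) → Adj w (t, k) (t, k + 1)
  | rightCusp_below {t k p : ℕ} : w[t]? = some (.rightCusp k) → p < k → Adj w (t, p) (t + 1, p)
  | rightCusp_above {t k p : ℕ} : w[t]? = some (.rightCusp k) → k ≤ p → Adj w (t, p + 2) (t + 1, p)

/-- An oriented generic front of a Legendrian knot: a closed word of singular points which is
nonempty and has a single component. -/
structure KnotFront where
  /-- The singular points, from left to right. -/
  events : List OrientedEvent
  closed : Run events [] []
  nonempty : events ≠ []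
  connected : ∀ (t p t' p' : ℕ) (s s' : List Bool),
    Run (events.take t) [] s → p < s.length → Run (events.take t') [] s' → p' < s'.length →
      Relation.EqvGen (Adj (events.map OrientedEvent.forget)) (t, p) (t', p')

/-! ### Legendrian isotopy -/

/-- Planar isotopies through fronts change the order of the singular points (`planar`: the first
point lies below the second one).  The other constructors are the Legendrian Reidemeister moves:
`r1_above`, `r1_below` replace the strand `k` by a strand with a crossing and two cusps; the moves
`r2_*` push the tip of a cusp through a neighbouring strand; `r3` moves a strand across a crossing.
-/
inductive LocalMove : List FrontEvent → List FrontEvent → Prop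
  | planar (e g : FrontEvent) :
      LocalMove [e, g.shift (e.pos + e.outputs)] [g.shift (e.pos + e.inputs), e]
  | r1_above (k : ℕ) : LocalMove [] [.leftCusp (k + 1), .crossing k, .rightCusp (k + 1)]
  | r1_below (k : ℕ) : LocalMove [] [.leftCusp k, .crossing (k + 1), .rightCusp k]
  | r2_left_below (k : ℕ) :
      LocalMove [.leftCusp k] [.leftCusp (k + 1), .crossing k, .crossing (k + 1)]
  | r2_left_above (k : ℕ) :
      LocalMove [.leftCusp (k + 1)] [.leftCusp k, .crossing (k + 1), .crossing k]
  | r2_right_below (k : ℕ) :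
      LocalMove [.rightCusp k] [.crossing (k + 1), .crossing k, .rightCusp (k + 1)]
  | r2_right_above (k : ℕ) :
      LocalMove [.rightCusp (k + 1)] [.crossing k, .crossing (k + 1), .rightCusp k]
  | r3 (k : ℕ) :
      LocalMove [.crossing k, .crossing (k + 1), .crossing k]
        [.crossing (k + 1), .crossing k, .crossing (k + 1)]

/-- Two oriented knot fronts differ by one move inside a vertical strip; outside the strip the
fronts and their orientations agree. -/
def KnotFront.Move (K K' : KnotFront) : Prop :=
  ∃ u m m' v : List OrientedEvent, K.events = u ++ m ++ v ∧ K'.events = u ++ m' ++ v ∧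
    LocalMove (m.map OrientedEvent.forget) (m'.map OrientedEvent.forget)

/-- Oriented Legendrian knots up to Legendrian isotopy: oriented fronts up to the equivalence
relation generated by planar isotopies and Legendrian Reidemeister moves. -/
def LegendrianKnot : Type := Quot KnotFront.Move

/-! ### Classical invariants -/

/-- `P - N - C / 2`. -/
def tbOf (w : List OrientedEvent) : ℚ :=
  (w.countP OrientedEvent.isPositive : ℚ) - (w.countP OrientedEvent.isNegative : ℚ)
    - (1 / 2) * (w.countP OrientedEvent.isCusp : ℚ)

/-- `(D - U) / 2`. -/
def rotOf (w : List OrientedEvent) : ℚ :=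
  (1 / 2) * ((w.countP OrientedEvent.isDownCusp : ℚ) - (w.countP OrientedEvent.isUpCusp : ℚ))

theorem tbOf_congr {u v : List OrientedEvent}
    (h : 2 * u.countP OrientedEvent.isPositive + 2 * v.countP OrientedEvent.isNegative
        + v.countP OrientedEvent.isCusp
      = 2 * v.countP OrientedEvent.isPositive + 2 * u.countP OrientedEvent.isNegative
        + u.countP OrientedEvent.isCusp) : tbOf u = tbOf v := by
  have := congrArg (Nat.cast (R := ℚ)) h
  push_cast at this
  simp only [tbOf]
  linarith

theorem rotOf_congr {u v : List OrientedEvent}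
    (h : u.countP OrientedEvent.isDownCusp + v.countP OrientedEvent.isUpCusp
      = v.countP OrientedEvent.isDownCusp + u.countP OrientedEvent.isUpCusp) :
    rotOf u = rotOf v := by
  have := congrArg (Nat.cast (R := ℚ)) h
  push_cast at this
  simp only [rotOf]
  linarith

theorem tbOf_append (u v : List OrientedEvent) : tbOf (u ++ v) = tbOf u + tbOf v := by
  simp only [tbOf, List.countP_append]; push_cast; ring

theorem rotOf_append (u v : List OrientedEvent) : rotOf (u ++ v) = rotOf u + rotOf v := by
  simp only [rotOf, List.countP_append]; push_cast; ring

theorem Run.append_iff {u v : List OrientedEvent} {s s' : List Bool} :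
    Run (u ++ v) s s' ↔ ∃ t, Run u s t ∧ Run v t s' := by
  induction u generalizing s with
  | nil =>
    constructor
    · intro h; exact ⟨s, .nil s, h⟩
    · rintro ⟨t, ⟨⟩, h⟩; exact h
  | cons e u ih =>
    constructor
    · intro h
      cases h with
      | cons h1 h2 =>
        obtain ⟨t, h3, h4⟩ := ih.1 h2
        exact ⟨t, .cons h1 h3, h4⟩
    · rintro ⟨t, h, h4⟩
      cases h with
      | cons h1 h2 => exact .cons h1 (ih.2 ⟨t, h2, h4⟩)

theorem Run.nil_iff {s s' : List Bool} : Run [] s s' ↔ s' = s := by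
  constructor
  · rintro ⟨⟩; rfl
  · rintro rfl; exact .nil _

theorem Run.cons_iff {e : OrientedEvent} {w : List OrientedEvent} {s s'' : List Bool} :
    Run (e :: w) s s'' ↔ ∃ s', e.Step s s' ∧ Run w s' s'' := by
  constructor
  · intro h
    cases h with
    | cons h1 h2 => exact ⟨_, h1, h2⟩
  · rintro ⟨s', h1, h2⟩; exact .cons h1 h2

namespace OrientedEvent

theorem step_leftCusp {k : ℕ} {up : Bool} {s s' : List Bool} :
    Step (.leftCusp k up) s s' ↔
      ∃ l r, l.length = k ∧ s = l ++ r ∧ s' = l ++ (!up) :: up :: r := by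
  constructor
  · intro h; cases h; exact ⟨_, _, rfl, rfl, rfl⟩
  · rintro ⟨l, r, rfl, rfl, rfl⟩; exact .leftCusp l r up

theorem step_crossing {k : ℕ} {a b : Bool} {s s' : List Bool} :
    Step (.crossing k a b) s s' ↔
      ∃ l r, l.length = k ∧ s = l ++ a :: b :: r ∧ s' = l ++ b :: a :: r := by
  constructor
  · intro h; cases h; exact ⟨_, _, rfl, rfl, rfl⟩
  · rintro ⟨l, r, rfl, rfl, rfl⟩; exact .crossing l r a b

theorem step_rightCusp {k : ℕ} {up : Bool} {s s' : List Bool} :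
    Step (.rightCusp k up) s s' ↔
      ∃ l r, l.length = k ∧ s = l ++ up :: (!up) :: r ∧ s' = l ++ r := by
  constructor
  · intro h; cases h; exact ⟨_, _, rfl, rfl, rfl⟩
  · rintro ⟨l, r, rfl, rfl, rfl⟩; exact .rightCusp l r up

theorem Step.leftUnique {e : OrientedEvent} {s t s' : List Bool} (h : e.Step s s')
    (h' : e.Step t s') : s = t := by
  cases e <;> simp only [step_leftCusp, step_crossing, step_rightCusp] at h h' <;>
  · obtain ⟨l, r, h1, rfl, rfl⟩ := h
    obtain ⟨l', r', h2, rfl, h3⟩ := h'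
    obtain ⟨rfl, h4⟩ := List.append_inj h3 (h1.trans h2.symm)
    simp_all

end OrientedEvent

namespace OrientedEvent

theorem Step.rightUnique {e : OrientedEvent} {s t t' : List Bool} (h : e.Step s t)
    (h' : e.Step s t') : t = t' := by
  cases e <;> simp only [step_leftCusp, step_crossing, step_rightCusp] at h h' <;>
  · obtain ⟨l, r, h1, rfl, rfl⟩ := h
    obtain ⟨l', r', h2, h3, rfl⟩ := h'
    obtain ⟨rfl, h4⟩ := List.append_inj h3 (h1.trans h2.symm)
    simp_all

end OrientedEvent

theorem Run.rightUnique {w : List OrientedEvent} {s t t' : List Bool} (h : Run w s t)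
    (h' : Run w s t') : t = t' := by
  induction w generalizing s with
  | nil => rw [Run.nil_iff] at h h'; exact h.trans h'.symm
  | cons e w ih =>
    obtain ⟨a, h1, h2⟩ := Run.cons_iff.1 h
    obtain ⟨b, h3, h4⟩ := Run.cons_iff.1 h'
    obtain rfl := h1.rightUnique h3
    exact ih h2 h4

theorem Run.leftUnique {w : List OrientedEvent} {s t s' : List Bool} (h : Run w s s')
    (h' : Run w t s') : s = t := by
  induction w generalizing s t with
  | nil => rw [Run.nil_iff] at h h'; exact h.symm.trans h'
  | cons e w ih =>
    obtain ⟨a, h1, h2⟩ := Run.cons_iff.1 h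
    obtain ⟨b, h3, h4⟩ := Run.cons_iff.1 h'
    obtain rfl := ih h2 h4
    exact h1.leftUnique h3
namespace OrientedEvent

/-- The same singular point with `m` more strands below it. -/
def shift (m : ℕ) : OrientedEvent → OrientedEvent
  | leftCusp k up => leftCusp (m + k) up
  | crossing k a b => crossing (m + k) a b
  | rightCusp k up => rightCusp (m + k) up

theorem step_shift_iff {e : OrientedEvent} {l r s' : List Bool} :
    Step (e.shift l.length) (l ++ r) s' ↔ ∃ r', s' = l ++ r' ∧ Step e r r' := by
  constructor
  · intro h
    cases e <;> simp only [shift, step_leftCusp, step_crossing, step_rightCusp] at h ⊢ <;>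
    · obtain ⟨l', r', h1, h2, rfl⟩ := h
      obtain ⟨h3, h4⟩ := List.append_inj (s₁ := l) (s₂ := l'.take l.length)
        (t₁ := r) (t₂ := l'.drop l.length ++ _)
        (by rw [h2, ← List.append_assoc, List.take_append_drop]) (by simp; omega)
      refine ⟨_, ?_, l'.drop l.length, r', by simp; omega, h4, rfl⟩
      conv_lhs => rw [← List.take_append_drop l.length l', ← h3, List.append_assoc]
  · rintro ⟨r', rfl, h⟩
    cases e <;> simp only [shift, step_leftCusp, step_crossing, step_rightCusp] at h ⊢ <;>
    · obtain ⟨l', r', rfl, rfl, rfl⟩ := h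
      exact ⟨l ++ l', r', by simp, by simp, by simp⟩

theorem Step.label {e e' : OrientedEvent} {s s' : List Bool} (h : e.Step s s')
    (h' : e'.Step s s') (hf : e.forget = e'.forget) : e = e' := by
  cases e <;> cases e' <;> simp [forget] at hf <;> subst hf <;>
  simp only [step_leftCusp, step_crossing, step_rightCusp] at h h' <;>
  · obtain ⟨l, r, h1, h2, h3⟩ := h
    obtain ⟨l', r', h4, h5, h6⟩ := h'
    have h7 := List.append_inj (h2.symm.trans h5) (h1.trans h4.symm)
    have h8 := List.append_inj (h3.symm.trans h6) (h1.trans h4.symm)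
    simp_all

theorem Step.pos_le {e : OrientedEvent} {s s' : List Bool} (h : e.Step s s') :
    e.forget.pos ≤ s.length := by
  cases h <;> simp [forget, FrontEvent.pos]

theorem step_leftCusp_zero {l r s' : List Bool} {up : Bool} :
    Step (.leftCusp l.length up) (l ++ r) s' ↔ s' = l ++ (!up) :: up :: r := by
  have := step_shift_iff (e := .leftCusp 0 up) (l := l) (r := r) (s' := s')
  simpa [shift, step_leftCusp] using this

theorem step_crossing_zero {l r s' : List Bool} {a b : Bool} :
    Step (.crossing l.length a b) (l ++ r) s' ↔ ∃ t, r = a :: b :: t ∧ s' = l ++ b :: a :: t := by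
  refine (step_shift_iff (e := .crossing 0 a b)).trans ?_
  simp only [step_crossing, List.length_eq_zero_iff]
  constructor
  · rintro ⟨_, rfl, _, t, rfl, h1, h2⟩; exact ⟨t, h1, by rw [h2]; rfl⟩
  · rintro ⟨t, rfl, rfl⟩; exact ⟨_, rfl, [], t, rfl, rfl, rfl⟩

theorem step_rightCusp_zero {l r s' : List Bool} {up : Bool} :
    Step (.rightCusp l.length up) (l ++ r) s' ↔ ∃ t, r = up :: (!up) :: t ∧ s' = l ++ t := by
  refine (step_shift_iff (e := .rightCusp 0 up)).trans ?_
  simp only [step_rightCusp, List.length_eq_zero_iff]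
  constructor
  · rintro ⟨_, rfl, _, t, rfl, h1, h2⟩; exact ⟨t, h1, by rw [h2]; rfl⟩
  · rintro ⟨t, rfl, rfl⟩; exact ⟨_, rfl, [], t, rfl, rfl, rfl⟩

theorem step_leftCusp_one {l r s' : List Bool} {up : Bool} :
    Step (.leftCusp (l.length + 1) up) (l ++ r) s' ↔
      ∃ x t, r = x :: t ∧ s' = l ++ x :: (!up) :: up :: t := by
  rcases r with _ | ⟨x, r⟩
  · simp only [reduceCtorEq, false_and, exists_false, iff_false]
    intro h
    simpa [forget, FrontEvent.pos] using h.pos_le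
  · have := step_leftCusp_zero (l := l ++ [x]) (r := r) (s' := s') (up := up)
    simpa using this

theorem step_crossing_one {l r s' : List Bool} {a b : Bool} :
    Step (.crossing (l.length + 1) a b) (l ++ r) s' ↔
      ∃ x t, r = x :: a :: b :: t ∧ s' = l ++ x :: b :: a :: t := by
  rcases r with _ | ⟨x, r⟩
  · simp only [reduceCtorEq, false_and, exists_false, iff_false]
    intro h
    simpa [forget, FrontEvent.pos] using h.pos_le
  · have := step_crossing_zero (l := l ++ [x]) (r := r) (s' := s') (a := a) (b := b)
    simp only [List.length_append, List.length_singleton, List.append_assoc,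
      List.singleton_append] at this
    rw [this]
    constructor
    · rintro ⟨t, rfl, rfl⟩; exact ⟨x, t, rfl, rfl⟩
    · rintro ⟨y, t, h, rfl⟩
      obtain ⟨rfl, rfl⟩ := List.cons.inj h
      exact ⟨t, rfl, rfl⟩

theorem step_rightCusp_one {l r s' : List Bool} {up : Bool} :
    Step (.rightCusp (l.length + 1) up) (l ++ r) s' ↔
      ∃ x t, r = x :: up :: (!up) :: t ∧ s' = l ++ x :: t := by
  rcases r with _ | ⟨x, r⟩
  · simp only [reduceCtorEq, false_and, exists_false, iff_false]
    intro h
    simpa [forget, FrontEvent.pos] using h.pos_le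
  · have := step_rightCusp_zero (l := l ++ [x]) (r := r) (s' := s') (up := up)
    simp only [List.length_append, List.length_singleton, List.append_assoc,
      List.singleton_append] at this
    rw [this]
    constructor
    · rintro ⟨t, rfl, rfl⟩; exact ⟨x, t, rfl, rfl⟩
    · rintro ⟨y, t, h, rfl⟩
      obtain ⟨rfl, rfl⟩ := List.cons.inj h
      exact ⟨t, rfl, rfl⟩

theorem forget_eq_leftCusp {e : OrientedEvent} {k : ℕ} :
    e.forget = .leftCusp k ↔ ∃ up, e = .leftCusp k up := by
  cases e <;> simp [forget]

theorem forget_eq_crossing {e : OrientedEvent} {k : ℕ} :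
    e.forget = .crossing k ↔ ∃ a b, e = .crossing k a b := by
  cases e <;> simp [forget]

theorem forget_eq_rightCusp {e : OrientedEvent} {k : ℕ} :
    e.forget = .rightCusp k ↔ ∃ up, e = .rightCusp k up := by
  cases e <;> simp [forget]

theorem forget_eq_shift {e : OrientedEvent} {f : FrontEvent} {m : ℕ}
    (h : e.forget = f.shift m) : ∃ e₀ : OrientedEvent, e = e₀.shift m ∧ e₀.forget = f := by
  cases f with
  | leftCusp k =>
    obtain ⟨up, rfl⟩ := forget_eq_leftCusp.1 h
    exact ⟨.leftCusp k up, rfl, rfl⟩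
  | crossing k =>
    obtain ⟨a, b, rfl⟩ := forget_eq_crossing.1 h
    exact ⟨.crossing k a b, rfl, rfl⟩
  | rightCusp k =>
    obtain ⟨up, rfl⟩ := forget_eq_rightCusp.1 h
    exact ⟨.rightCusp k up, rfl, rfl⟩

/-- Every singular point acts on a block of strands. -/
theorem Step.block {e : OrientedEvent} {s s' : List Bool} (h : e.Step s s') :
    ∃ l i o r, s = l ++ i ++ r ∧ s' = l ++ o ++ r ∧ l.length = e.forget.pos ∧
      i.length = e.forget.inputs ∧ o.length = e.forget.outputs ∧
      ∀ r', e.Step (l ++ i ++ r') (l ++ o ++ r') := by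
  cases h with
  | leftCusp l r up =>
    exact ⟨l, [], [!up, up], r, by simp, by simp, rfl, rfl, rfl,
      fun r' => by simpa using Step.leftCusp l r' up⟩
  | crossing l r a b =>
    exact ⟨l, [a, b], [b, a], r, by simp, by simp, rfl, rfl, rfl,
      fun r' => by simpa using Step.crossing l r' a b⟩
  | rightCusp l r up =>
    exact ⟨l, [up, !up], [], r, by simp, by simp, rfl, rfl, rfl,
      fun r' => by simpa using Step.rightCusp l r' up⟩

theorem tbOf_shift (e : OrientedEvent) (m : ℕ) : tbOf [e.shift m] = tbOf [e] := by
  cases e <;> simp [tbOf, shift, isPositive, isNegative, isCusp, List.countP_cons]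

theorem rotOf_shift (e : OrientedEvent) (m : ℕ) : rotOf [e.shift m] = rotOf [e] := by
  cases e <;> simp [rotOf, shift, isDownCusp, isUpCusp, List.countP_cons] <;> rfl

end OrientedEvent

open OrientedEvent

theorem planar_invariance {e e' g g' : OrientedEvent} {s t : List Bool}
    (he : e.forget = e'.forget) (hg : g.forget = g'.forget)
    (h : Run [e, g.shift (e.forget.pos + e.forget.outputs)] s t)
    (h' : Run [g'.shift (e.forget.pos + e.forget.inputs), e'] s t) : e = e' ∧ g = g' := by
  simp only [Run.cons_iff, Run.nil_iff] at h h'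
  obtain ⟨s₁, h1, _, h2, rfl⟩ := h
  obtain ⟨s₂, h3, _, h4, rfl⟩ := h'
  obtain ⟨l, i, o, r, rfl, rfl, hl, hi, ho, hr⟩ := h1.block
  rw [← hl, ← ho, ← List.length_append, step_shift_iff] at h2
  rw [← hl, ← hi, ← List.length_append, step_shift_iff] at h3
  obtain ⟨r₁, rfl, h5⟩ := h2
  obtain ⟨r₂, rfl, h6⟩ := h3
  obtain ⟨l', i', o', r', h7, h8, hl', hi', ho', hr'⟩ := h4.block
  rw [← he] at hl' hi' ho'
  obtain ⟨h9, rfl⟩ := List.append_inj h7 (by simp; omega)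
  obtain ⟨h10, rfl⟩ := List.append_inj h8 (by simp; omega)
  refine ⟨?_, h5.label h6 hg⟩
  exact (hr r₁).label h4 he

theorem Run.pos_le_of_map {w : List OrientedEvent} {s t : List Bool} {f : FrontEvent}
    {fs : List FrontEvent} (h : Run w s t) (hw : w.map forget = f :: fs) : f.pos ≤ s.length := by
  obtain ⟨e, w, rfl, rfl, -⟩ := List.map_eq_cons_iff.1 hw
  obtain ⟨_, h1, -⟩ := Run.cons_iff.1 h
  exact h1.pos_le

theorem exists_split {s : List Bool} {n k : ℕ} (h : n ≤ s.length) (hk : k ≤ n) :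
    ∃ l r, l.length = k ∧ s = l ++ r :=
  ⟨s.take k, s.drop k, by simp; omega, by simp⟩

theorem LocalMove.invariance {m m' : List OrientedEvent} {s t : List Bool}
    (hm : LocalMove (m.map forget) (m'.map forget)) (h : Run m s t) (h' : Run m' s t) :
    tbOf m = tbOf m' ∧ rotOf m = rotOf m' := by
  generalize hf : m.map forget = f at hm
  generalize hf' : m'.map forget = f' at hm
  cases hm with
  | planar e g =>
    simp only [List.map_eq_cons_iff, List.map_eq_nil_iff] at hf hf'
    obtain ⟨e₁, _, rfl, rfl, g₁, _, rfl, hg1, rfl⟩ := hf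
    obtain ⟨g₂, _, rfl, hg2, e₂, _, rfl, he2, rfl⟩ := hf'
    obtain ⟨g₁, rfl, rfl⟩ := forget_eq_shift hg1
    obtain ⟨g₂, rfl, hg⟩ := forget_eq_shift hg2
    obtain ⟨rfl, rfl⟩ := planar_invariance he2.symm hg.symm h h'
    have ht := fun a b : OrientedEvent => tbOf_append [a] [b]
    have hr := fun a b : OrientedEvent => rotOf_append [a] [b]
    simp only [List.singleton_append] at ht hr
    rw [ht, ht, hr, hr]
    simp only [tbOf_shift, rotOf_shift]
    constructor <;> ring
  | r1_above k =>
    obtain ⟨l, r, rfl, rfl⟩ := exists_split (k := k) (h'.pos_le_of_map hf')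
      (by simp [FrontEvent.pos])
    simp only [List.map_eq_cons_iff, List.map_eq_nil_iff, forget_eq_leftCusp, forget_eq_crossing,
      forget_eq_rightCusp] at hf hf'
    subst hf
    obtain ⟨_, _, rfl, ⟨_, rfl⟩, _, _, rfl, ⟨_, _, rfl⟩, _, _, rfl, ⟨_, rfl⟩, rfl⟩ := hf'
    simp only [Run.cons_iff, Run.nil_iff] at h h'
    have ae := h
    obtain ⟨_, b0, _, b1, _, b2, be⟩ := h'
    rw [step_leftCusp_one] at b0
    obtain ⟨_, _, b0, rfl⟩ := b0
    rw [step_crossing_zero] at b1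
    obtain ⟨_, b1, rfl⟩ := b1
    rw [step_rightCusp_one] at b2
    obtain ⟨_, _, b2, rfl⟩ := b2
    rw [ae, List.append_cancel_left_eq] at be
    refine ⟨tbOf_congr ?_, rotOf_congr ?_⟩ <;>
    simp only [List.countP_cons, List.countP_nil, isPositive, isNegative, isCusp, isDownCusp,
      isUpCusp] <;>
    grind
  | r1_below k =>
    obtain ⟨l, r, rfl, rfl⟩ := exists_split (k := k) (h'.pos_le_of_map hf')
      (by simp [FrontEvent.pos])
    simp only [List.map_eq_cons_iff, List.map_eq_nil_iff, forget_eq_leftCusp, forget_eq_crossing,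
      forget_eq_rightCusp] at hf hf'
    subst hf
    obtain ⟨_, _, rfl, ⟨_, rfl⟩, _, _, rfl, ⟨_, _, rfl⟩, _, _, rfl, ⟨_, rfl⟩, rfl⟩ := hf'
    simp only [Run.cons_iff, Run.nil_iff] at h h'
    have ae := h
    obtain ⟨_, b0, _, b1, _, b2, be⟩ := h'
    rw [step_leftCusp_zero] at b0
    subst b0
    rw [step_crossing_one] at b1
    obtain ⟨_, _, b1, rfl⟩ := b1
    rw [step_rightCusp_zero] at b2
    obtain ⟨_, b2, rfl⟩ := b2
    rw [ae, List.append_cancel_left_eq] at be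
    refine ⟨tbOf_congr ?_, rotOf_congr ?_⟩ <;>
    simp only [List.countP_cons, List.countP_nil, isPositive, isNegative, isCusp, isDownCusp,
      isUpCusp] <;>
    grind
  | r2_left_below k =>
    obtain ⟨l, r, rfl, rfl⟩ := exists_split (k := k) (h'.pos_le_of_map hf')
      (by simp [FrontEvent.pos])
    simp only [List.map_eq_cons_iff, List.map_eq_nil_iff, forget_eq_leftCusp, forget_eq_crossing]
      at hf hf'
    obtain ⟨_, _, rfl, ⟨c, rfl⟩, rfl⟩ := hf
    obtain ⟨_, _, rfl, ⟨_, rfl⟩, _, _, rfl, ⟨_, _, rfl⟩, _, _, rfl, ⟨_, _, rfl⟩, rfl⟩ := hf'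
    simp only [Run.cons_iff, Run.nil_iff] at h h'
    obtain ⟨_, a0, ae⟩ := h
    rw [step_leftCusp_zero] at a0
    subst a0
    obtain ⟨_, b0, _, b1, _, b2, be⟩ := h'
    rw [step_leftCusp_one] at b0
    obtain ⟨_, _, b0, rfl⟩ := b0
    rw [step_crossing_zero] at b1
    obtain ⟨_, b1, rfl⟩ := b1
    rw [step_crossing_one] at b2
    obtain ⟨_, _, b2, rfl⟩ := b2
    rw [ae, List.append_cancel_left_eq] at be
    refine ⟨tbOf_congr ?_, rotOf_congr ?_⟩ <;>
    simp only [List.countP_cons, List.countP_nil, isPositive, isNegative, isCusp, isDownCusp,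
      isUpCusp] <;>
    cases c <;> grind
  | r2_left_above k =>
    obtain ⟨l, r, rfl, rfl⟩ := exists_split (k := k) (h'.pos_le_of_map hf')
      (by simp [FrontEvent.pos])
    simp only [List.map_eq_cons_iff, List.map_eq_nil_iff, forget_eq_leftCusp, forget_eq_crossing]
      at hf hf'
    obtain ⟨_, _, rfl, ⟨c, rfl⟩, rfl⟩ := hf
    obtain ⟨_, _, rfl, ⟨_, rfl⟩, _, _, rfl, ⟨_, _, rfl⟩, _, _, rfl, ⟨_, _, rfl⟩, rfl⟩ := hf'
    simp only [Run.cons_iff, Run.nil_iff] at h h'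
    obtain ⟨_, a0, ae⟩ := h
    rw [step_leftCusp_one] at a0
    obtain ⟨_, _, a0, rfl⟩ := a0
    obtain ⟨_, b0, _, b1, _, b2, be⟩ := h'
    rw [step_leftCusp_zero] at b0
    subst b0
    rw [step_crossing_one] at b1
    obtain ⟨_, _, b1, rfl⟩ := b1
    rw [step_crossing_zero] at b2
    obtain ⟨_, b2, rfl⟩ := b2
    rw [ae, List.append_cancel_left_eq] at be
    refine ⟨tbOf_congr ?_, rotOf_congr ?_⟩ <;>
    simp only [List.countP_cons, List.countP_nil, isPositive, isNegative, isCusp, isDownCusp,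
      isUpCusp] <;>
    cases c <;> grind
  | r2_right_below k =>
    obtain ⟨l, r, rfl, rfl⟩ := exists_split (k := k) (h'.pos_le_of_map hf')
      (by simp [FrontEvent.pos])
    simp only [List.map_eq_cons_iff, List.map_eq_nil_iff, forget_eq_crossing, forget_eq_rightCusp]
      at hf hf'
    obtain ⟨_, _, rfl, ⟨c, rfl⟩, rfl⟩ := hf
    obtain ⟨_, _, rfl, ⟨_, _, rfl⟩, _, _, rfl, ⟨_, _, rfl⟩, _, _, rfl, ⟨_, rfl⟩, rfl⟩ := hf'
    simp only [Run.cons_iff, Run.nil_iff] at h h'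
    obtain ⟨_, a0, ae⟩ := h
    rw [step_rightCusp_zero] at a0
    obtain ⟨_, a0, rfl⟩ := a0
    obtain ⟨_, b0, _, b1, _, b2, be⟩ := h'
    rw [step_crossing_one] at b0
    obtain ⟨_, _, b0, rfl⟩ := b0
    rw [step_crossing_zero] at b1
    obtain ⟨_, b1, rfl⟩ := b1
    rw [step_rightCusp_one] at b2
    obtain ⟨_, _, b2, rfl⟩ := b2
    rw [ae, List.append_cancel_left_eq] at be
    refine ⟨tbOf_congr ?_, rotOf_congr ?_⟩ <;>
    simp only [List.countP_cons, List.countP_nil, isPositive, isNegative, isCusp, isDownCusp,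
      isUpCusp] <;>
    cases c <;> grind
  | r2_right_above k =>
    obtain ⟨l, r, rfl, rfl⟩ := exists_split (k := k) (h'.pos_le_of_map hf')
      (by simp [FrontEvent.pos])
    simp only [List.map_eq_cons_iff, List.map_eq_nil_iff, forget_eq_crossing, forget_eq_rightCusp]
      at hf hf'
    obtain ⟨_, _, rfl, ⟨c, rfl⟩, rfl⟩ := hf
    obtain ⟨_, _, rfl, ⟨_, _, rfl⟩, _, _, rfl, ⟨_, _, rfl⟩, _, _, rfl, ⟨_, rfl⟩, rfl⟩ := hf'
    simp only [Run.cons_iff, Run.nil_iff] at h h'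
    obtain ⟨_, a0, ae⟩ := h
    rw [step_rightCusp_one] at a0
    obtain ⟨_, _, a0, rfl⟩ := a0
    obtain ⟨_, b0, _, b1, _, b2, be⟩ := h'
    rw [step_crossing_zero] at b0
    obtain ⟨_, b0, rfl⟩ := b0
    rw [step_crossing_one] at b1
    obtain ⟨_, _, b1, rfl⟩ := b1
    rw [step_rightCusp_zero] at b2
    obtain ⟨_, b2, rfl⟩ := b2
    rw [ae, List.append_cancel_left_eq] at be
    refine ⟨tbOf_congr ?_, rotOf_congr ?_⟩ <;>
    simp only [List.countP_cons, List.countP_nil, isPositive, isNegative, isCusp, isDownCusp,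
      isUpCusp] <;>
    cases c <;> grind
  | r3 k =>
    obtain ⟨l, r, rfl, rfl⟩ := exists_split (k := k) (h'.pos_le_of_map hf')
      (by simp [FrontEvent.pos])
    simp only [List.map_eq_cons_iff, List.map_eq_nil_iff, forget_eq_crossing]
      at hf hf'
    obtain ⟨_, _, rfl, ⟨_, _, rfl⟩, _, _, rfl, ⟨_, _, rfl⟩, _, _, rfl, ⟨_, _, rfl⟩, rfl⟩ := hf
    obtain ⟨_, _, rfl, ⟨_, _, rfl⟩, _, _, rfl, ⟨_, _, rfl⟩, _, _, rfl, ⟨_, _, rfl⟩, rfl⟩ := hf'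
    simp only [Run.cons_iff, Run.nil_iff] at h h'
    obtain ⟨_, a0, _, a1, _, a2, ae⟩ := h
    rw [step_crossing_zero] at a0
    obtain ⟨_, a0, rfl⟩ := a0
    rw [step_crossing_one] at a1
    obtain ⟨_, _, a1, rfl⟩ := a1
    rw [step_crossing_zero] at a2
    obtain ⟨_, a2, rfl⟩ := a2
    obtain ⟨_, b0, _, b1, _, b2, be⟩ := h'
    rw [step_crossing_one] at b0
    obtain ⟨_, _, b0, rfl⟩ := b0
    rw [step_crossing_zero] at b1
    obtain ⟨_, b1, rfl⟩ := b1
    rw [step_crossing_one] at b2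
    obtain ⟨_, _, b2, rfl⟩ := b2
    rw [ae, List.append_cancel_left_eq] at be
    refine ⟨tbOf_congr ?_, rotOf_congr ?_⟩ <;>
    simp only [List.countP_cons, List.countP_nil, isPositive, isNegative, isCusp, isDownCusp,
      isUpCusp] <;>
    grind

theorem KnotFront.Move.invariance {K K' : KnotFront} (h : K.Move K') :
    tbOf K.events = tbOf K'.events ∧ rotOf K.events = rotOf K'.events := by
  obtain ⟨u, m, m', v, h1, h2, hm⟩ := h
  have hK := K.closed
  have hK' := K'.closed
  rw [h1, Run.append_iff] at hK
  rw [h2, Run.append_iff] at hK'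
  obtain ⟨t, hum, hv⟩ := hK
  obtain ⟨t', hum', hv'⟩ := hK'
  obtain rfl := hv.leftUnique hv'
  obtain ⟨s, hu, hm1⟩ := Run.append_iff.1 hum
  obtain ⟨s', hu', hm2⟩ := Run.append_iff.1 hum'
  obtain rfl := hu.rightUnique hu'
  obtain ⟨h3, h4⟩ := hm.invariance hm1 hm2
  simp only [h1, h2, tbOf_append, rotOf_append, h3, h4, and_self]

namespace LegendrianKnot

/-- The Thurston–Bennequin number `P - N - C / 2`, computed in any front. -/
def tb : LegendrianKnot → ℚ :=
  Quot.lift (fun K : KnotFront => tbOf K.events) fun _ _ h => h.invariance.1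

/-- The rotation number `(D - U) / 2`, computed in any front. -/
def rot : LegendrianKnot → ℚ :=
  Quot.lift (fun K : KnotFront => rotOf K.events) fun _ _ h => h.invariance.2

end LegendrianKnot

/-! ### Legendrian mosaics -/

/-- The ten Legendrian mosaic tiles, described by the edges of the tile (before the rotation by
`45°`) which their strands join.  After the counterclockwise rotation by `45°` the edges `left`,
`bottom`, `right`, `top` face south-west, south-east, north-east, north-west. -/
inductive Tile : Type
  /-- empty -/
  | T0
  /-- left - bottom; rotated: a cap without cusp -/
  | T1
  /-- bottom - right; rotated: a left cusp -/
  | T2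
  /-- right - top; rotated: a cup without cusp -/
  | T3
  /-- left - top; rotated: a right cusp -/
  | T4
  /-- left - right; rotated: a strand of slope `1` -/
  | T5
  /-- top - bottom; rotated: a strand of slope `-1` -/
  | T6
  /-- the strands of `T1` and `T3`; no cusp -/
  | T7
  /-- the strands of `T4` and `T2`; rotated: a right cusp and, to the right of it, a left cusp -/
  | T8
  /-- the strands of `T5` and `T6`, which cross; `T6` is the overstrand -/
  | T10
  deriving DecidableEq

namespace Tile

/-- There is a connection point on the left edge. -/
def left : Tile → Bool
  | T1 | T4 | T5 | T7 | T8 | T10 => true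
  | T0 | T2 | T3 | T6 => false

/-- There is a connection point on the right edge. -/
def right : Tile → Bool
  | T2 | T3 | T5 | T7 | T8 | T10 => true
  | T0 | T1 | T4 | T6 => false

/-- There is a connection point on the top edge. -/
def top : Tile → Bool
  | T3 | T4 | T6 | T7 | T8 | T10 => true
  | T0 | T1 | T2 | T5 => false

/-- There is a connection point on the bottom edge. -/
def bottom : Tile → Bool
  | T1 | T2 | T6 | T7 | T8 | T10 => true
  | T0 | T3 | T4 | T5 => false

/-- The singular points of the front inside the rotated tile, from left to right, if `k` strands
pass below the tile. -/
def events (k : ℕ) : Tile → List FrontEvent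
  | T2 => [.leftCusp k]
  | T4 => [.rightCusp k]
  | T8 => [.rightCusp k, .leftCusp k]
  | T10 => [.crossing k]
  | T0 | T1 | T3 | T5 | T6 | T7 => []

/-- The number of strands that leave the rotated tile to the right. -/
def outputs (T : Tile) : ℕ := T.bottom.toNat + T.right.toNat

end Tile

/-- An `n × n` array of Legendrian tiles; `M i j` is the tile in row `i` (from the top) and column
`j` (from the left) of the grid before the rotation by `45°`. -/
def Mosaic (n : ℕ) : Type := Fin n → Fin n → Tile

namespace Mosaic

variable {n : ℕ}

/-- The connection points of adjacent tiles coincide, and there are none on the boundary. -/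
structure SuitablyConnected (M : Mosaic n) : Prop where
  horizontal : ∀ i j j' : Fin n, j.val + 1 = j'.val → (M i j).right = (M i j').left
  vertical : ∀ i i' j : Fin n, i.val + 1 = i'.val → (M i j).bottom = (M i' j).top
  left : ∀ i j : Fin n, j.val = 0 → (M i j).left = false
  right : ∀ i j : Fin n, j.val + 1 = n → (M i j).right = false
  top : ∀ i j : Fin n, i.val = 0 → (M i j).top = false
  bottom : ∀ i j : Fin n, i.val + 1 = n → (M i j).bottom = false

/-- In the rotated grid the centre of the tile `(i, j)` has horizontal coordinate `i + j` and
vertical coordinate `j - i`, in units of half a diagonal of a tile.  `M.column d` lists the tiles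
with horizontal coordinate `d` from bottom to top. -/
def column (M : Mosaic n) (d : ℕ) : List Tile :=
  (List.finRange n).flatMap fun j =>
    ((List.finRange n).filter fun i => i.val + j.val = d).map fun i => M i j

/-- The singular points in a vertical column of tiles, listed from bottom to top, if `k` strands
pass below the column. -/
def columnEvents (k : ℕ) : List Tile → List FrontEvent
  | [] => []
  | T :: Ts => T.events k ++ columnEvents (k + T.outputs) Ts

/-- The front depicted by a mosaic, as a word of singular points; the singular points are read
column by column from left to right, and from bottom to top in every column. -/
def front (M : Mosaic n) : List FrontEvent :=
  (List.range (2 * n - 1)).flatMap fun d => columnEvents 0 (M.column d)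

/-- `M` is a suitably connected mosaic which, with some orientation, depicts a front of `Λ`. -/
def Represents (M : Mosaic n) (Λ : LegendrianKnot) : Prop :=
  M.SuitablyConnected ∧
    ∃ K : KnotFront, K.events.map OrientedEvent.forget = M.front ∧ Quot.mk KnotFront.Move K = Λ

end Mosaic

/-- The mosaic number: the smallest `n` such that `Λ` can be represented on a Legendrian
`n`-mosaic (`⊤` if there were no such `n`). -/
noncomputable def LegendrianKnot.mosaicNumber (Λ : LegendrianKnot) : ℕ∞ :=
  ⨅ (n : ℕ) (_ : ∃ M : Mosaic n, M.Represents Λ), (n : ℕ∞)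

end Legendrian

namespace Legendrian

open OrientedEvent

/-! ### The height potential -/

/-! Fix `σ = 1` or `σ = -1`. It suffices to bound `4 σ rot + tb` by `n ^ 2`, since the better of the
two signs gives `4 |rot| + tb`. Charging each tile its own share of `4 σ rot + tb` does not work: a
tile `T8` with two cusps traversed in the same direction can contribute `4 - 1 = 3`. The excess is
paid for by the strands of slope `±1`, because a closed curve has to regain the height that it loses
at its cusps.

The bookkeeping device is `potential`. Across a tile its change is the total rise of the strands
inside, each followed along its own orientation: reversing a strand flips its sign and exchanges its
ends, and a cusp rises or falls by one between its two branches. Adding `σ` times the rise to the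
share of the tile makes every tile contribute at most `1` (`Tile.signedInvariant_add_potential_le`).
A down cusp loses one unit of height while its rotation term is `2 σ`, so the correction halves that
term.

The corrections telescope from column to column, because the edge midpoints by which strands leave
one column are those by which they enter the next (`SuitablyConnected.columnOutHeights_eq`). No
strand exists before the first column or after the last one, so the total correction is zero and the
sum over all tiles is at most `n ^ 2`. -/

/-- The sign of a strand direction: `1` for rightward, `-1` for leftward. -/
def dirSign (b : Bool) : ℚ := if b then 1 else -1

/-- The sum of the heights of the strands over a vertical line, counted with the signs of their
directions. -/
def potential (s : List Bool) (H : List ℤ) : ℚ :=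
  (List.zipWith (fun b (h : ℤ) => dirSign b * h) s H).sum

/-- `List.zipWith` truncates at the shorter list, so splitting needs directions and heights to be
aligned. This is why equality of lengths is carried through all the later estimates. -/
theorem potential_append {s t : List Bool} {H J : List ℤ} (h : s.length = H.length) :
    potential (s ++ t) (H ++ J) = potential s H + potential t J := by
  simp [potential, List.zipWith_append h]

/-- The quantity `4 σ rot + tb`, which is additive in the word. -/
def signedInvariant (σ : ℚ) (w : List OrientedEvent) : ℚ := 4 * σ * rotOf w + tbOf w

theorem signedInvariant_append (σ : ℚ) (u v : List OrientedEvent) :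
    signedInvariant σ (u ++ v) = signedInvariant σ u + signedInvariant σ v := by
  simp only [signedInvariant, rotOf_append, tbOf_append]; ring

theorem signedInvariant_nil (σ : ℚ) : signedInvariant σ [] = 0 := by
  simp [signedInvariant, rotOf, tbOf]

/-! ### A single tile -/

namespace Tile

/-- The heights at which strands enter a rotated tile, listed from bottom to top; `h` is the height
of its left edge. -/
def inHeights (h : ℤ) (T : Tile) : List ℤ :=
  (if T.left then [h] else []) ++ (if T.top then [h + 1] else [])

/-- The heights at which strands leave a rotated tile, listed from bottom to top; `h` is the height
of its bottom edge. -/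
def outHeights (h : ℤ) (T : Tile) : List ℤ :=
  (if T.bottom then [h] else []) ++ (if T.right then [h + 1] else [])

theorem length_outHeights (h : ℤ) (T : Tile) : (T.outHeights h).length = T.outputs := by
  cases T <;> rfl

/-- The local estimate, checked tile by tile. The strands `l` below and `u` above the tile pass
unchanged; `r` enters it and `r'` leaves it. The value of `h` cancels, as each tile has as much
rightward flow leaving as entering. -/
theorem signedInvariant_add_potential_le {σ : ℚ} (hσ : σ = 1 ∨ σ = -1) (T : Tile) (h : ℤ)
    {w : List OrientedEvent} {l r u t : List Bool} (hw : w.map forget = T.events l.length)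
    (hr : r.length = (T.inHeights h).length) (hrun : Run w (l ++ (r ++ u)) t) :
    ∃ r', t = l ++ (r' ++ u) ∧ r'.length = (T.outHeights h).length ∧
      signedInvariant σ w + σ * (potential r' (T.outHeights h) - potential r (T.inHeights h))
        ≤ 1 := by
  cases T <;>
    simp only [inHeights, outHeights, left, right, top, bottom, events, if_true, if_false,
      List.nil_append, List.append_nil, List.cons_append, List.length_cons, List.length_nil,
      Bool.false_eq_true, List.map_eq_nil_iff, List.map_eq_cons_iff, forget_eq_leftCusp,
      forget_eq_rightCusp, forget_eq_crossing, List.length_eq_zero_iff, zero_add,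
      List.length_eq_one_iff, Nat.reduceAdd, List.length_eq_two] at hw hr ⊢
  case T0 =>
    subst hw hr
    exact ⟨[], Run.nil_iff.1 hrun, rfl, by simp [signedInvariant_nil]⟩
  case T1 =>
    obtain ⟨a, rfl⟩ := hr
    subst hw
    exact ⟨[a], Run.nil_iff.1 hrun, ⟨a, rfl⟩, by simp [signedInvariant_nil]⟩
  case T3 =>
    obtain ⟨a, rfl⟩ := hr
    subst hw
    exact ⟨[a], Run.nil_iff.1 hrun, ⟨a, rfl⟩, by simp [signedInvariant_nil]⟩
  -- Both strands leave at the height at which they entered and do not cross, so the contribution is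
  -- zero.
  case T7 =>
    obtain ⟨a, b, rfl⟩ := hr
    subst hw
    exact ⟨[a, b], Run.nil_iff.1 hrun, ⟨a, b, rfl⟩, by simp [signedInvariant_nil]⟩
  case T5 =>
    obtain ⟨a, rfl⟩ := hr
    subst hw
    refine ⟨[a], Run.nil_iff.1 hrun, ⟨a, rfl⟩, ?_⟩
    -- The strand rises or falls by one along its orientation and there is no singular point, so the
    -- contribution is `±1`.
    rcases hσ with rfl | rfl <;> cases a <;>
      simp [signedInvariant_nil, potential, dirSign]
  case T6 =>
    obtain ⟨a, rfl⟩ := hr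
    subst hw
    refine ⟨[a], Run.nil_iff.1 hrun, ⟨a, rfl⟩, ?_⟩
    rcases hσ with rfl | rfl <;> cases a <;>
      simp [signedInvariant_nil, potential, dirSign]
  case T2 =>
    subst hr
    obtain ⟨_, _, rfl, ⟨c, rfl⟩, rfl⟩ := hw
    simp only [Run.cons_iff, Run.nil_iff, step_leftCusp_zero] at hrun
    obtain ⟨_, rfl, rfl⟩ := hrun
    refine ⟨[!c, c], rfl, ⟨_, _, rfl⟩, ?_⟩
    -- With `ε = 1` for a down cusp and `ε = -1` for an up cusp, the rotation term is `2 σ ε`, the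
    -- rise term `-σ ε` and the `tb` term `-1/2`. The total `σ ε - 1/2` is at most `1/2`, and the
    -- same holds for a right cusp.
    rcases hσ with rfl | rfl <;> cases c <;>
      simp [signedInvariant, rotOf, tbOf, potential, dirSign, isPositive, isNegative, isCusp,
        isDownCusp, isUpCusp] <;> linarith
  case T4 =>
    obtain ⟨a, b, rfl⟩ := hr
    obtain ⟨_, _, rfl, ⟨c, rfl⟩, rfl⟩ := hw
    simp only [Run.cons_iff, Run.nil_iff, step_rightCusp_zero] at hrun
    obtain ⟨_, ⟨_, h1, rfl⟩, rfl⟩ := hrun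
    simp only [List.cons_append, List.nil_append, List.cons.injEq] at h1
    obtain ⟨rfl, rfl, rfl⟩ := h1
    refine ⟨[], rfl, rfl, ?_⟩
    rcases hσ with rfl | rfl <;> cases a <;>
      simp [signedInvariant, rotOf, tbOf, potential, dirSign, isPositive, isNegative, isCusp,
        isDownCusp, isUpCusp] <;> linarith
  case T8 =>
    obtain ⟨a, b, rfl⟩ := hr
    obtain ⟨_, _, rfl, ⟨c, rfl⟩, _, _, rfl, ⟨d, rfl⟩, rfl⟩ := hw
    simp only [Run.cons_iff, Run.nil_iff, step_rightCusp_zero] at hrun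
    obtain ⟨_, ⟨_, h1, rfl⟩, _, h2, rfl⟩ := hrun
    simp only [List.cons_append, List.nil_append, List.cons.injEq] at h1
    obtain ⟨rfl, rfl, rfl⟩ := h1
    rw [step_leftCusp_zero] at h2
    subst h2
    refine ⟨[!d, d], rfl, ⟨_, _, rfl⟩, ?_⟩
    -- Two independent cusps of at most `1/2` each; the bound `1` is attained.
    rcases hσ with rfl | rfl <;> cases a <;> cases d <;>
      simp [List.countP_cons, signedInvariant, rotOf, tbOf, potential, dirSign, isPositive, isNegative,
        isCusp, isDownCusp, isUpCusp] <;> linarith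
  case T10 =>
    obtain ⟨a, b, rfl⟩ := hr
    obtain ⟨_, _, rfl, ⟨c, d, rfl⟩, rfl⟩ := hw
    simp only [Run.cons_iff, Run.nil_iff, step_crossing_zero] at hrun
    obtain ⟨_, ⟨_, h1, rfl⟩, rfl⟩ := hrun
    simp only [List.cons_append, List.nil_append, List.cons.injEq] at h1
    obtain ⟨rfl, rfl, rfl⟩ := h1
    refine ⟨[b, a], rfl, ⟨_, _, rfl⟩, ?_⟩
    -- If the strands point to the same side, their rises cancel and the crossing gives `1`.
    -- Otherwise the crossing gives `-1`, and the rises add up to `±2`.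
    rcases hσ with rfl | rfl <;> cases a <;> cases b <;>
      simp [signedInvariant, rotOf, tbOf, potential, dirSign, isPositive, isNegative, isCusp,
        isDownCusp, isUpCusp] <;> linarith

end Tile

/-! ### A column of tiles -/

namespace Mosaic

/-- The heights at which strands enter a column of tiles with given heights. -/
def columnInHeights (Ts : List (ℤ × Tile)) : List ℤ := Ts.flatMap fun p => p.2.inHeights p.1

/-- The heights at which strands leave a column of tiles with given heights. -/
def columnOutHeights (Ts : List (ℤ × Tile)) : List ℤ := Ts.flatMap fun p => p.2.outHeights p.1

/-- The singular points of a column are read from bottom to top, so the single-tile estimates add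
up. `l` holds the strands below the tiles still to be read, including the outgoing strands of the
tiles already passed. -/
theorem signedInvariant_add_potential_le_length {σ : ℚ} (hσ : σ = 1 ∨ σ = -1)
    (Ts : List (ℤ × Tile)) {w : List OrientedEvent} {l r t : List Bool}
    (hw : w.map forget = columnEvents l.length (Ts.map Prod.snd))
    (hr : r.length = (columnInHeights Ts).length) (hrun : Run w (l ++ r) t) :
    ∃ r', t = l ++ r' ∧ r'.length = (columnOutHeights Ts).length ∧
      signedInvariant σ w + σ * (potential r' (columnOutHeights Ts)
        - potential r (columnInHeights Ts)) ≤ Ts.length := by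
  induction Ts generalizing w l r t with
  | nil =>
    simp only [List.map_nil, columnEvents, List.map_eq_nil_iff] at hw
    subst hw
    exact ⟨r, Run.nil_iff.1 hrun, hr, by simp [signedInvariant_nil, columnInHeights,
      columnOutHeights, potential]⟩
  | cons p Ts ih =>
    obtain ⟨h, T⟩ := p
    simp only [List.map_cons, columnEvents] at hw
    obtain ⟨w₁, w₂, rfl, hw₁, hw₂⟩ := List.map_eq_append_iff.1 hw
    simp only [columnInHeights, columnOutHeights, List.flatMap_cons, List.length_append] at hr ⊢
    change r.length = _ + (columnInHeights Ts).length at hr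
    change ∃ r', _ ∧ _ = _ + (columnOutHeights Ts).length ∧ _ + σ *
      (potential r' (_ ++ columnOutHeights Ts) - potential r (_ ++ columnInHeights Ts)) ≤ _
    obtain ⟨r₁, r₂, rfl, hr₁⟩ : ∃ r₁ r₂, r = r₁ ++ r₂ ∧ r₁.length = (T.inHeights h).length :=
      ⟨r.take (T.inHeights h).length, r.drop (T.inHeights h).length, by simp, by simp; omega⟩
    obtain ⟨t₁, hrun₁, hrun₂⟩ := Run.append_iff.1 hrun
    obtain ⟨r₁', rfl, hr₁', hle₁⟩ := T.signedInvariant_add_potential_le hσ h hw₁ hr₁ hrun₁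
    -- The strands `r₁'` leaving the first tile now lie below the remaining tiles, in agreement with
    -- the offset `k + T.outputs` in `columnEvents`.
    rw [← List.append_assoc] at hrun₂
    obtain ⟨r₂', rfl, hr₂', hle₂⟩ := ih (l := l ++ r₁') (r := r₂)
      (by rw [hw₂, List.length_append, hr₁', Tile.length_outHeights])
      (by simp only [List.length_append] at hr; omega) hrun₂
    refine ⟨r₁' ++ r₂', by simp, by simp [hr₁', hr₂'], ?_⟩
    rw [potential_append hr₁', potential_append hr₁, signedInvariant_append]
    push_cast [List.length_cons]
    linarith

/-! ### Heights in the columns of a mosaic, and matching of consecutive columns -/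

variable {n : ℕ}

/-- The column of tiles with horizontal coordinate `d`, together with their heights. -/
def heightColumn (M : Mosaic n) (d : ℕ) : List (ℤ × Tile) :=
  (List.finRange n).flatMap fun j : Fin n =>
    ((List.finRange n).filter fun i => i.val + j.val = d).map fun i => (2 * (j.val : ℤ) - d, M i j)

theorem map_snd_heightColumn (M : Mosaic n) (d : ℕ) :
    (M.heightColumn d).map Prod.snd = M.column d := by
  simp [heightColumn, column, List.map_flatMap, Function.comp_def]

theorem mem_heightColumn {M : Mosaic n} {d : ℕ} {p : ℤ × Tile} :
    p ∈ M.heightColumn d ↔ ∃ i j : Fin n, i.val + j.val = d ∧ (2 * (j : ℤ) - d, M i j) = p := by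
  simp only [heightColumn, List.mem_flatMap, List.mem_map, List.mem_filter, List.mem_finRange,
    true_and, decide_eq_true_eq]
  exact ⟨fun ⟨j, i, h⟩ => ⟨i, j, h⟩, fun ⟨i, j, h⟩ => ⟨j, i, h⟩⟩

/-- On the antidiagonal `i + j = d` the height `2 j - d` equals `j - i`, so different tiles of a
column are at least two units apart. A tile uses only the heights `h` and `h + 1`, hence the tiles
occupy disjoint height ranges. -/
theorem pairwise_heightColumn (M : Mosaic n) (d : ℕ) :
    (M.heightColumn d).Pairwise fun p q => p.1 + 1 < q.1 := by
  rw [heightColumn, List.pairwise_flatMap]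
  constructor
  · intro j _
    -- For fixed `j` at most one `i` satisfies `i + j = d`, so there is no pair to compare.
    rw [List.pairwise_map, List.pairwise_filter]
    refine (List.pairwise_lt_finRange n).imp fun {i i'} hlt h h' => ?_
    simp only [decide_eq_true_eq] at h h'
    have : i.val < i'.val := hlt
    omega
  · refine (List.pairwise_lt_finRange n).imp fun {j j'} hlt p hp q hq => ?_
    simp only [List.mem_map] at hp hq
    obtain ⟨_, _, rfl⟩ := hp
    obtain ⟨_, _, rfl⟩ := hq
    have : j.val < j'.val := hlt
    dsimp only
    omega

/-- Strict sorting makes the list determined by its members, so that heights of adjacent columns can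
be compared one edge at a time. -/
theorem sortedLT_columnInHeights (M : Mosaic n) (d : ℕ) :
    (columnInHeights (M.heightColumn d)).SortedLT := by
  rw [List.sortedLT_iff_pairwise, columnInHeights, List.pairwise_flatMap]
  constructor
  · rintro ⟨h, T⟩ _
    cases T <;> simp [Tile.inHeights, Tile.left, Tile.top]
  · refine (M.pairwise_heightColumn d).imp fun {p q} hlt x hx y hy => ?_
    simp only [Tile.inHeights, List.mem_append, List.mem_ite_nil_right, List.mem_singleton] at hx hy
    omega

theorem sortedLT_columnOutHeights (M : Mosaic n) (d : ℕ) :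
    (columnOutHeights (M.heightColumn d)).SortedLT := by
  rw [List.sortedLT_iff_pairwise, columnOutHeights, List.pairwise_flatMap]
  constructor
  · rintro ⟨h, T⟩ _
    cases T <;> simp [Tile.outHeights, Tile.bottom, Tile.right]
  · refine (M.pairwise_heightColumn d).imp fun {p q} hlt x hx y hy => ?_
    simp only [Tile.outHeights, List.mem_append, List.mem_ite_nil_right, List.mem_singleton]
      at hx hy
    omega

theorem mem_columnInHeights {M : Mosaic n} {d : ℕ} {h : ℤ} :
    h ∈ columnInHeights (M.heightColumn d) ↔ ∃ i j : Fin n, i.val + j.val = d ∧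
      ((M i j).left = true ∧ h = 2 * (j : ℤ) - d ∨
        (M i j).top = true ∧ h = 2 * (j : ℤ) - d + 1) := by
  simp only [columnInHeights, List.mem_flatMap, mem_heightColumn, Tile.inHeights, List.mem_append,
    List.mem_ite_nil_right, List.mem_singleton]
  constructor
  · rintro ⟨_, ⟨i, j, hd, rfl⟩, h⟩; exact ⟨i, j, hd, h⟩
  · rintro ⟨i, j, hd, h⟩; exact ⟨_, ⟨i, j, hd, rfl⟩, h⟩

theorem mem_columnOutHeights {M : Mosaic n} {d : ℕ} {h : ℤ} :
    h ∈ columnOutHeights (M.heightColumn d) ↔ ∃ i j : Fin n, i.val + j.val = d ∧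
      ((M i j).bottom = true ∧ h = 2 * (j : ℤ) - d ∨
        (M i j).right = true ∧ h = 2 * (j : ℤ) - d + 1) := by
  simp only [columnOutHeights, List.mem_flatMap, mem_heightColumn, Tile.outHeights,
    List.mem_append, List.mem_ite_nil_right, List.mem_singleton]
  constructor
  · rintro ⟨_, ⟨i, j, hd, rfl⟩, h⟩; exact ⟨i, j, hd, h⟩
  · rintro ⟨i, j, hd, h⟩; exact ⟨_, ⟨i, j, hd, rfl⟩, h⟩

theorem SuitablyConnected.columnInHeights_zero {M : Mosaic n} (hM : M.SuitablyConnected) :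
    columnInHeights (M.heightColumn 0) = [] := by
  rw [List.eq_nil_iff_forall_not_mem]
  intro h hh
  obtain ⟨i, j, hd, ⟨hl, -⟩ | ⟨ht, -⟩⟩ := mem_columnInHeights.1 hh
  · rw [hM.left i j (by omega)] at hl; cases hl
  · rw [hM.top i j (by omega)] at ht; cases ht

/-- The strands that leave a column enter the next one. -/
theorem SuitablyConnected.columnOutHeights_eq {M : Mosaic n} (hM : M.SuitablyConnected) (d : ℕ) :
    columnOutHeights (M.heightColumn d) = columnInHeights (M.heightColumn (d + 1)) := by
  refine (M.sortedLT_columnOutHeights d).eq_of_mem_iff (M.sortedLT_columnInHeights (d + 1))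
    fun h => ?_
  rw [mem_columnOutHeights, mem_columnInHeights]
  constructor
  · rintro ⟨i, j, hd, ⟨hb, hh⟩ | ⟨hr, hh⟩⟩
    · by_cases hi : i.val + 1 = n
      · rw [hM.bottom i j hi] at hb; cases hb
      -- The bottom edge of `(i, j)`, at height `2 j - d`, is the top edge of `(i + 1, j)`, at
      -- height `2 j - (d + 1) + 1`.
      · refine ⟨⟨i + 1, by omega⟩, j, by dsimp only; omega, .inr ⟨?_, by push_cast; omega⟩⟩
        rw [← hM.vertical i _ j rfl, hb]
    · by_cases hj : j.val + 1 = n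
      · rw [hM.right i j hj] at hr; cases hr
      -- The right edge of `(i, j)`, at height `2 j - d + 1`, is the left edge of `(i, j + 1)`, at
      -- height `2 (j + 1) - (d + 1)`.
      · refine ⟨i, ⟨j + 1, by omega⟩, by dsimp only; omega, .inl ⟨?_, by push_cast; omega⟩⟩
        rw [← hM.horizontal i j _ rfl, hr]
  · rintro ⟨i, j, hd, ⟨hl, hh⟩ | ⟨ht, hh⟩⟩
    · by_cases hj : j.val = 0
      · rw [hM.left i j hj] at hl; cases hl
      · have hj' : (j.val - 1) + 1 = j.val := by omega
        refine ⟨i, ⟨j - 1, by omega⟩, by dsimp only; omega, .inr ⟨?_, ?_⟩⟩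
        · rw [hM.horizontal i _ j hj', hl]
        · push_cast at hh ⊢; omega
    · by_cases hi : i.val = 0
      · rw [hM.top i j hi] at ht; cases ht
      · have hi' : (i.val - 1) + 1 = i.val := by omega
        refine ⟨⟨i - 1, by omega⟩, j, by dsimp only; omega, .inl ⟨?_, by push_cast at hh; omega⟩⟩
        rw [hM.vertical _ i j hi', ht]

/-! ### Counting tiles -/

theorem length_heightColumn (M : Mosaic n) (d : ℕ) :
    (M.heightColumn d).length =
      ∑ j : Fin n, ∑ i : Fin n, if i.val + j.val = d then 1 else 0 := by
  rw [heightColumn, List.length_flatMap, ← List.ofFn_eq_map, List.sum_ofFn]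
  refine Finset.sum_congr rfl fun j _ => ?_
  rw [List.length_map, ← List.sum_ofFn, List.ofFn_eq_map]
  induction List.finRange n with
  | nil => rfl
  | cons i l ih => by_cases h : i.val + j.val = d <;> simp [h, ih, Nat.add_comm 1]

/-- Each tile `(i, j)` lies in the single column `d = i + j`, so after exchanging the sums it is
counted at most once. -/
theorem sum_length_heightColumn_le (M : Mosaic n) (m : ℕ) :
    ∑ d ∈ Finset.range m, (M.heightColumn d).length ≤ n ^ 2 := by
  simp only [length_heightColumn]
  rw [Finset.sum_comm]
  calc _ ≤ ∑ _j : Fin n, ∑ _i : Fin n, 1 := by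
        refine Finset.sum_le_sum fun j _ => ?_
        rw [Finset.sum_comm]
        refine Finset.sum_le_sum fun i _ => ?_
        rw [Finset.sum_ite_eq]
        split_ifs <;> simp
    _ = n ^ 2 := by simp [sq]

/-! ### Telescoping over the columns and the final bound -/

/-- The first `m` columns of a suitably connected mosaic. -/
theorem SuitablyConnected.signedInvariant_columns_le {σ : ℚ} (hσ : σ = 1 ∨ σ = -1) {M : Mosaic n}
    (hM : M.SuitablyConnected) (m : ℕ) {w : List OrientedEvent} {s : List Bool}
    (hw : w.map forget = (List.range m).flatMap fun d => columnEvents 0 (M.column d))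
    (hrun : Run w [] s) :
    s.length = (columnInHeights (M.heightColumn m)).length ∧
      signedInvariant σ w + σ * potential s (columnInHeights (M.heightColumn m))
        ≤ (∑ d ∈ Finset.range m, (M.heightColumn d).length : ℕ) := by
  induction m generalizing w s with
  | zero =>
    simp only [List.range_zero, List.flatMap_nil, List.map_eq_nil_iff] at hw
    subst hw
    obtain rfl := Run.nil_iff.1 hrun
    simp [hM.columnInHeights_zero, signedInvariant_nil, potential]
  | succ m ih =>
    rw [List.range_succ, List.flatMap_append, List.flatMap_singleton] at hw
    obtain ⟨w₁, w₂, rfl, hw₁, hw₂⟩ := List.map_eq_append_iff.1 hw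
    obtain ⟨t, hrun₁, hrun₂⟩ := Run.append_iff.1 hrun
    obtain ⟨hlen, hle⟩ := ih hw₁ hrun₁
    obtain ⟨r', rfl, hr', hle'⟩ := signedInvariant_add_potential_le_length hσ (M.heightColumn m)
      (l := []) (by rw [map_snd_heightColumn]; exact hw₂) hlen hrun₂
    -- The outgoing potential of column `m` becomes the incoming potential of column `m + 1`, so the
    -- intermediate potentials cancel.
    rw [hM.columnOutHeights_eq] at hr' hle'
    refine ⟨hr', ?_⟩
    rw [Finset.sum_range_succ, signedInvariant_append]
    push_cast at hle ⊢
    linarith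

theorem SuitablyConnected.signedInvariant_le {σ : ℚ} (hσ : σ = 1 ∨ σ = -1) {M : Mosaic n}
    (hM : M.SuitablyConnected) {w : List OrientedEvent} (hw : w.map forget = M.front)
    (hrun : Run w [] []) : signedInvariant σ w ≤ (n : ℚ) ^ 2 := by
  have h₁ := (hM.signedInvariant_columns_le hσ (2 * n - 1) hw hrun).2
  have h₂ : ((∑ d ∈ Finset.range (2 * n - 1), (M.heightColumn d).length : ℕ) : ℚ) ≤ (n : ℚ) ^ 2 :=
    mod_cast M.sum_length_heightColumn_le (2 * n - 1)
  -- The front ends with no strands, so the final potential vanishes whatever the list of heights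
  -- is.
  simp only [potential, List.zipWith_nil_left, List.sum_nil, mul_zero, add_zero] at h₁
  exact h₁.trans h₂

theorem Represents.four_mul_abs_rot_add_tb_le {M : Mosaic n} {Λ : LegendrianKnot}
    (h : M.Represents Λ) : 4 * |Λ.rot| + Λ.tb ≤ (n : ℚ) ^ 2 := by
  obtain ⟨hM, K, hK, rfl⟩ := h
  have h₁ := hM.signedInvariant_le (.inl rfl) hK K.closed
  have h₂ := hM.signedInvariant_le (.inr rfl) hK K.closed
  -- `rot` and `tb` of the class of `K` unfold to the counts in the word of `K`, which is the front
  -- depicted by the mosaic.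
  change 4 * |rotOf K.events| + tbOf K.events ≤ _
  simp only [signedInvariant] at h₁ h₂
  rcases abs_cases (rotOf K.events) with ⟨h, -⟩ | ⟨h, -⟩ <;> rw [h] <;> linarith

end Mosaic

end Legendrian

theorem mainTheorem2 (Λ : Legendrian.LegendrianKnot) (h : 0 ≤ 4 * |Λ.rot| + Λ.tb) :
    ((⌈Real.sqrt ((4 * |Λ.rot| + Λ.tb : ℚ) : ℝ)⌉₊ : ℕ) : ℕ∞) ≤ Λ.mosaicNumber := by
  -- A lower bound for the infimum is a bound for every size `n` that admits a representing mosaic.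
  refine le_iInf₂ fun n ⟨M, hM⟩ => ?_
  rw [Nat.cast_le, Nat.ceil_le]
  refine Real.sqrt_le_iff.2 ⟨n.cast_nonneg, ?_⟩
  exact_mod_cast hM.four_mul_abs_rot_add_tb_le
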